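/- Let $f:\mathbb{Z}^n\to\mathbb{R}\cup\{+\infty\}$. Let $\overline f:\mathbb{R}^n\to\mathbb{R}\cup\{\pm\infty\}$ be its convex envelope, i.e. the pointwise supremum of all affine functions $x\mapsto\langle p,x\rangle+\alpha$ $(p\in\mathbb{R}^n,\alpha\in\mathbb{R})$ satisfying $\langle p,y\rangle+\alpha\le f(y)$ for all $y\in\mathbb{Z}^n$. For $x\in\mathbb{R}^n$ let $N(x)=\{z\in\mathbb{Z}^n : |x_i-z_i|<1\ (i=1,\dots,n)\}$. A nonempty set $S\subseteq\mathbb{Z}^n$ is called integrally convex if $\bigcup_{x\in\mathbb{R}^n}\mathrm{conv}(S\cap N(x))$ is convex. The function $f$ is called integrally convex if its local convex extension $$\tilde f(x)=\min\Big\{\sum_{y\in N(x)}\lambda_y f(y) : \sum_{y\in N(x)}\lambda_y y=x,\ \sum_{y\in N(x)}\lambda_y=1,\ \lambda_y\ge 0\ (y\in N(x))\Big\}\qquad(x\in\mathbb{R}^n)$$ (with $0\cdot(+\infty)=0$) is convex on $\mathbb{R}^n$. For $p\in\mathbb{R}^n$ put $f[-p](x)=f(x)-\langle p,x\rangle$ $(x\in\mathbb{Z}^n)$,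 and let $\arg\min f[-p]$ be the set of its minimizers over $\mathbb{Z}^n$. **Theorem.** Assume that $\overline f$ is a polyhedral convex function (its epigraph in $\mathbb{R}^n\times\mathbb{R}$ is described by finitely many linear inequalities) and that $\overline f(x)=f(x)$ for all $x\in\mathbb{Z}^n$. Then $f$ is integrally convex if and only if $\arg\min f[-p]$ is an integrally convex set for each $p\in\mathbb{R}^n$ for which $f[-p]$ attains a finite minimum. -/

import Mathlib

namespace IntConv

/-- The embedding of the integer lattice `ℤⁿ` in `ℝⁿ`. -/
def toReal {n : ℕ} (z : Fin n → ℤ) : Fin n → ℝ := fun i => (z i : ℝ)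

/-- The integral neighborhood `N(x)` of `x ∈ ℝⁿ`: the integer vectors between `⌊x⌋` and `⌈x⌉`,
taken componentwise. See `mem_intNbhd` for the description by strict inequalities. -/
noncomputable def intNbhd {n : ℕ} (x : Fin n → ℝ) : Finset (Fin n → ℤ) :=
  Finset.Icc (fun i => ⌊x i⌋) (fun i => ⌈x i⌉)

theorem mem_intNbhd {n : ℕ} (x : Fin n → ℝ) (z : Fin n → ℤ) :
    z ∈ intNbhd x ↔ ∀ i, |x i - (z i : ℝ)| < 1 := by
  have key : ∀ i, (⌊x i⌋ ≤ z i ∧ z i ≤ ⌈x i⌉) ↔ |x i - (z i : ℝ)| < 1 := by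
    intro i
    rw [abs_lt, Int.floor_le_iff, Int.le_ceil_iff]
    constructor
    · rintro ⟨h1, h2⟩
      constructor <;> linarith
    · rintro ⟨h1, h2⟩
      constructor <;> linarith
  simp only [intNbhd, Finset.mem_Icc, Pi.le_def, ← forall_and, key]

/-- A set `S ⊆ ℤⁿ` is integrally convex if it is nonempty and the union over `x ∈ ℝⁿ` of the
local convex hulls `conv (S ∩ N(x))` is convex. -/
def IsIntegrallyConvexSet {n : ℕ} (S : Set (Fin n → ℤ)) : Prop :=
  S.Nonempty ∧
    Convex ℝ (⋃ x : Fin n → ℝ, convexHull ℝ (toReal '' (S ∩ (intNbhd x : Set (Fin n → ℤ)))))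

/-- The epigraph, in `ℝⁿ × ℝ`, of an extended-real-valued function on `ℝⁿ`. -/
def epigraph {n : ℕ} (g : (Fin n → ℝ) → EReal) : Set ((Fin n → ℝ) × ℝ) :=
  {q | g q.1 ≤ (q.2 : EReal)}

/-- Convexity of an extended-real-valued function: its epigraph is convex. -/
def IsConvexFun {n : ℕ} (g : (Fin n → ℝ) → EReal) : Prop :=
  Convex ℝ (epigraph g)

/-- A polyhedral convex function: its epigraph is a polyhedron in `ℝⁿ × ℝ`, i.e. it is described
by finitely many linear inequalities. -/
def IsPolyhedralConvexFun {n : ℕ} (g : (Fin n → ℝ) → EReal) : Prop :=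
  ∃ (m : ℕ) (a : Fin m → (Fin n → ℝ)) (b c : Fin m → ℝ),
    epigraph g = {q | ∀ k, a k ⬝ᵥ q.1 + b k * q.2 ≤ c k}

/-- The convex envelope of `f`: the pointwise supremum of all affine functions minorizing `f`. -/
noncomputable def convexEnvelope {n : ℕ} (f : (Fin n → ℤ) → EReal) (x : Fin n → ℝ) : EReal :=
  ⨆ (p : Fin n → ℝ) (α : ℝ) (_ : ∀ y : Fin n → ℤ, ((p ⬝ᵥ toReal y + α : ℝ) : EReal) ≤ f y),
    ((p ⬝ᵥ x + α : ℝ) : EReal)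

/-- The local convex extension of `f`: the least value of `∑ λ_y f(y)` over the representations
`x = ∑ λ_y y` of `x` as a convex combination of the points `y ∈ N(x)`, with `0 · (+∞) = 0`.
(For each `x` this is a finite linear program, so the infimum is a minimum.) -/
noncomputable def localConvexExtension {n : ℕ} (f : (Fin n → ℤ) → EReal) (x : Fin n → ℝ) :
    EReal :=
  sInf {t : EReal | ∃ w : (Fin n → ℤ) → ℝ,
    (∀ y ∈ intNbhd x, 0 ≤ w y) ∧ ∑ y ∈ intNbhd x, w y = 1 ∧
    ∑ y ∈ intNbhd x, w y • toReal y = x ∧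
    t = ∑ y ∈ intNbhd x, (w y : EReal) * f y}

/-- `f` is integrally convex if its local convex extension is convex on `ℝⁿ`. -/
def IsIntegrallyConvexFun {n : ℕ} (f : (Fin n → ℤ) → EReal) : Prop :=
  IsConvexFun (localConvexExtension f)

/-- The function `f[-p](x) = f(x) - ⟨p, x⟩`. -/
noncomputable def tilt {n : ℕ} (f : (Fin n → ℤ) → EReal) (p : Fin n → ℝ) :
    (Fin n → ℤ) → EReal :=
  fun x => f x - ((p ⬝ᵥ toReal x : ℝ) : EReal)

/-- The set of minimizers of `h` over `ℤⁿ`. -/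
def argmin {n : ℕ} (h : (Fin n → ℤ) → EReal) : Set (Fin n → ℤ) :=
  {x | ∀ y, h x ≤ h y}

/-- `h` attains a finite minimum. -/
def AttainsFiniteMin {n : ℕ} (h : (Fin n → ℤ) → EReal) : Prop :=
  ∃ x ∈ argmin h, h x ≠ ⊥ ∧ h x ≠ ⊤

end IntConv

namespace IntConv

open Filter Topology

/-! The sets `argmin (tilt f p)` with finite minimum are exactly the nonempty contact sets of affine
minorants of `f` (`IsMinorant.argmin_tilt`), so both directions are about contact sets.

If the local extension is convex, it lies below the minorant on the convex hull of its contact set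
`S`. A point `x` of that hull outside `conv (S ∩ N(x))` could be separated from this polytope.
Tilting the minorant slightly in the separating direction keeps it below `f` on the finite set
`N(x)` but raises it at `x`, a contradiction.

Conversely, the local extension is shown to equal the envelope, which is convex. Where the envelope
is finite, polyhedrality supplies a minorant touching it at `x`. Once `x` is known to lie in the
convex hull of the contact set, integral convexity of that set puts `x` in a local hull, and the two
functions agree there. Otherwise separate `x` from the hull and tilt again
(`mem_convexHull_contactSet`). The tilted function must now stay below `f` everywhere. The finitely
many affine pieces reduce this to finitely many contact sets, which may be infinite.

Infinite sets are handled by a discrete substitute for polyhedrality. Seen from any of its points,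
an integrally convex set lies in a cone spanned by vectors of `{-1,0,1}ⁿ`, so only finitely many
cones occur. Hence linear functions bounded below attain their minimum, and Dickson's lemma yields
recession directions that rule out infinite descent. -/

/-! ### Lattice points, local convex hulls and integrally convex sets -/

theorem toReal_injective {n : ℕ} : Function.Injective (toReal (n := n)) := by
  intro a b h
  funext i
  have hi : (a i : ℝ) = b i := congrFun h i
  exact_mod_cast hi

theorem toReal_add {n : ℕ} (a b : Fin n → ℤ) : toReal (a + b) = toReal a + toReal b := by
  funext i
  simp [toReal]

theorem toReal_sub {n : ℕ} (a b : Fin n → ℤ) : toReal (a - b) = toReal a - toReal b := by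
  funext i
  simp [toReal]

theorem self_mem_intNbhd {n : ℕ} (z : Fin n → ℤ) : z ∈ intNbhd (toReal z) := by
  rw [mem_intNbhd]
  simp [toReal]

theorem abs_sub_le_one_of_mem_intNbhd {n : ℕ} {x : Fin n → ℝ} {y z : Fin n → ℤ}
    (hy : y ∈ intNbhd x) (hz : z ∈ intNbhd x) (i : Fin n) :
    |(y i : ℝ) - z i| ≤ 1 := by
  rw [mem_intNbhd] at hy hz
  have h : |(y i : ℝ) - z i| < 2 := by
    have h1 := abs_lt.1 (hy i)
    have h2 := abs_lt.1 (hz i)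
    rw [abs_lt]
    constructor <;> linarith
  have h' : |y i - z i| < 2 := by exact_mod_cast h
  have h'' : |y i - z i| ≤ 1 := by omega
  exact_mod_cast h''

/-- A point of the convex hull of finitely many lattice points is a convex combination of them. -/
theorem exists_weights_of_mem_convexHull {n : ℕ} {T : Finset (Fin n → ℤ)} {x : Fin n → ℝ}
    (hx : x ∈ convexHull ℝ (toReal '' (T : Set (Fin n → ℤ)))) :
    ∃ w : (Fin n → ℤ) → ℝ, (∀ y ∈ T, 0 ≤ w y) ∧ ∑ y ∈ T, w y = 1 ∧
      ∑ y ∈ T, w y • toReal y = x := by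
  classical
  rw [← Finset.coe_image, Finset.mem_convexHull'] at hx
  obtain ⟨w, hw0, hw1, hwx⟩ := hx
  rw [Finset.sum_image toReal_injective.injOn] at hw1 hwx
  exact ⟨fun y => w (toReal y), fun y hy => hw0 _ (Finset.mem_image_of_mem _ hy), hw1, hwx⟩

theorem mem_convexHull_of_weights {n : ℕ} {T : Finset (Fin n → ℤ)} {S : Set (Fin n → ℤ)}
    {w : (Fin n → ℤ) → ℝ} (hw0 : ∀ y ∈ T, 0 ≤ w y) (hw1 : ∑ y ∈ T, w y = 1)
    (hS : ∀ y ∈ T, 0 < w y → y ∈ S) :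
    ∑ y ∈ T, w y • toReal y ∈ convexHull ℝ (toReal '' S) := by
  classical
  have hpos : ∀ y ∈ T, w y ≠ 0 → 0 < w y := fun y hy h => lt_of_le_of_ne (hw0 y hy) h.symm
  have e1 : ∑ y ∈ T with 0 < w y, w y = 1 := by
    rw [Finset.sum_filter_of_ne hpos, hw1]
  have e2 : ∑ y ∈ T with 0 < w y, w y • toReal y = ∑ y ∈ T, w y • toReal y := by
    refine Finset.sum_filter_of_ne fun y hy h => hpos y hy fun h0 => h ?_
    rw [h0, zero_smul]
  rw [← e2]
  refine (convex_convexHull ℝ _).sum_mem (fun y hy => ?_) e1 fun y hy => ?_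
  · exact (Finset.mem_filter.1 hy).2.le
  · obtain ⟨hyT, hy0⟩ := Finset.mem_filter.1 hy
    exact subset_convexHull ℝ _ ⟨y, hS y hyT hy0, rfl⟩

/-- A local convex hull only uses, at the point `x`, lattice points of `N(x)`. -/
theorem mem_convexHull_inter_intNbhd_self {n : ℕ} {S : Set (Fin n → ℤ)} {x x₀ : Fin n → ℝ}
    (hx : x ∈ convexHull ℝ (toReal '' (S ∩ (intNbhd x₀ : Set (Fin n → ℤ))))) :
    x ∈ convexHull ℝ (toReal '' (S ∩ (intNbhd x : Set (Fin n → ℤ)))) := by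
  classical
  have hT : S ∩ (intNbhd x₀ : Set (Fin n → ℤ)) = ((intNbhd x₀).filter (· ∈ S) :) := by
    ext y
    simp [and_comm]
  rw [hT] at hx
  obtain ⟨w, hw0, hw1, hwx⟩ := exists_weights_of_mem_convexHull hx
  set T := (intNbhd x₀).filter (· ∈ S)
  have key := mem_convexHull_of_weights (S := S ∩ (intNbhd x : Set (Fin n → ℤ))) hw0 hw1 ?_
  · rwa [hwx] at key
  · intro y hy hpos
    have hy' := Finset.mem_filter.1 hy
    refine ⟨hy'.2, ?_⟩
    rw [Finset.mem_coe, mem_intNbhd]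
    intro i
    -- The term `z = y` vanishes and the other differences are at most 1 in absolute value, so the
    -- bound is `1 - w y < 1`.
    have e : x i - y i = ∑ z ∈ T, w z * ((z i : ℝ) - y i) := by
      simp only [mul_sub, Finset.sum_sub_distrib, ← Finset.sum_mul, hw1, one_mul]
      rw [← hwx]
      simp [Finset.sum_apply, toReal]
    rw [e, ← Finset.add_sum_erase _ _ hy, sub_self, mul_zero, zero_add]
    rw [← Finset.add_sum_erase _ _ hy] at hw1
    calc |∑ z ∈ T.erase y, w z * ((z i : ℝ) - y i)|
        ≤ ∑ z ∈ T.erase y, |w z * ((z i : ℝ) - y i)| := Finset.abs_sum_le_sum_abs _ _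
      _ ≤ ∑ z ∈ T.erase y, w z := by
          refine Finset.sum_le_sum fun z hz => ?_
          have hz' := Finset.mem_of_mem_erase hz
          rw [abs_mul, abs_of_nonneg (hw0 z hz')]
          exact mul_le_of_le_one_right (hw0 z hz')
            (abs_sub_le_one_of_mem_intNbhd (Finset.mem_filter.1 hz').1 hy'.1 i)
      _ < 1 := by linarith

/-- The union of local hulls contains `S` and lies in its convex hull, so it is convex exactly when
it is the whole hull. A point lying in any local hull lies in its own, which makes the criterion
pointwise. -/
theorem isIntegrallyConvexSet_iff {n : ℕ} {S : Set (Fin n → ℤ)} :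
    IsIntegrallyConvexSet S ↔ S.Nonempty ∧ ∀ x ∈ convexHull ℝ (toReal '' S),
      x ∈ convexHull ℝ (toReal '' (S ∩ (intNbhd x : Set (Fin n → ℤ)))) := by
  refine and_congr_right fun _ => ⟨fun h x hx => ?_, fun h => ?_⟩
  · have hsub : convexHull ℝ (toReal '' S) ⊆
        ⋃ x : Fin n → ℝ, convexHull ℝ (toReal '' (S ∩ (intNbhd x : Set (Fin n → ℤ)))) := by
      refine convexHull_min ?_ h
      rintro _ ⟨z, hz, rfl⟩
      exact Set.mem_iUnion.2 ⟨toReal z,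
        subset_convexHull ℝ _ ⟨z, ⟨hz, self_mem_intNbhd z⟩, rfl⟩⟩
    obtain ⟨x₀, hx₀⟩ := Set.mem_iUnion.1 (hsub hx)
    exact mem_convexHull_inter_intNbhd_self hx₀
  · have e : (⋃ x : Fin n → ℝ, convexHull ℝ (toReal '' (S ∩ (intNbhd x : Set (Fin n → ℤ))))) =
        convexHull ℝ (toReal '' S) := by
      apply Set.Subset.antisymm
      · exact Set.iUnion_subset fun x =>
          convexHull_mono (Set.image_mono Set.inter_subset_left)
      · exact fun x hx => Set.mem_iUnion.2 ⟨x, h x hx⟩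
    rw [e]
    exact convex_convexHull ℝ _

/-- The convex hull of an integrally convex set is closed. -/
theorem IsIntegrallyConvexSet.isClosed_convexHull {n : ℕ} {S : Set (Fin n → ℤ)}
    (hS : IsIntegrallyConvexSet S) : IsClosed (convexHull ℝ (toReal '' S)) := by
  rw [← closure_subset_iff_isClosed]
  intro x hx
  -- For `y` within distance 1 of `x`, every point of `N(y)` is within 2 of `x`. Near `x` the hull
  -- is therefore that of a finite set.
  set B : Finset (Fin n → ℤ) := Finset.Icc (fun i => ⌊x i⌋ - 2) (fun i => ⌈x i⌉ + 2)
  have hfin : (toReal '' (S ∩ (B : Set (Fin n → ℤ)))).Finite :=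
    (B.finite_toSet.inter_of_right S).image _
  have hcl : IsClosed (convexHull ℝ (toReal '' (S ∩ (B : Set (Fin n → ℤ))))) :=
    (hfin.isCompact_convexHull ℝ).isClosed
  have hmono : convexHull ℝ (toReal '' (S ∩ (B : Set (Fin n → ℤ)))) ⊆
      convexHull ℝ (toReal '' S) := convexHull_mono (Set.image_mono Set.inter_subset_left)
  apply hmono
  rw [← hcl.closure_eq]
  have hx' : x ∈ closure (Metric.ball x 1 ∩ convexHull ℝ (toReal '' S)) :=
    Metric.isOpen_ball.inter_closure ⟨Metric.mem_ball_self one_pos, hx⟩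
  refine closure_mono ?_ hx'
  rintro y ⟨hyx, hy⟩
  refine convexHull_mono (Set.image_mono ?_) ((isIntegrallyConvexSet_iff.1 hS).2 y hy)
  refine Set.inter_subset_inter_right S fun z hz => ?_
  rw [Finset.mem_coe, mem_intNbhd] at hz
  have hd : ∀ i, ⌊x i⌋ - 2 ≤ z i ∧ z i ≤ ⌈x i⌉ + 2 := by
    intro i
    have h1 := abs_lt.1 (hz i)
    have h2 : |y i - x i| < 1 := lt_of_le_of_lt (by
      simpa [Real.dist_eq] using dist_le_pi_dist y x i) (Metric.mem_ball.1 hyx)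
    have h2 := abs_lt.1 h2
    have h3 := Int.floor_le (x i)
    have h4 := Int.le_ceil (x i)
    constructor
    · have : ((⌊x i⌋ - 2 : ℤ) : ℝ) ≤ z i := by push_cast; linarith
      exact_mod_cast this
    · have : (z i : ℝ) ≤ ((⌈x i⌉ + 2 : ℤ) : ℝ) := by push_cast; linarith
      exact_mod_cast this
  rw [Finset.mem_coe, Finset.mem_Icc]
  exact ⟨fun i => (hd i).1, fun i => (hd i).2⟩

/-! ### Cones of steps and minima of linear functions -/

/-- The steps `e ∈ {-1, 0, 1}ⁿ` that lead from `v` to a point of `S`. -/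
noncomputable def steps {n : ℕ} (S : Set (Fin n → ℤ)) (v : Fin n → ℤ) : Finset (Fin n → ℤ) :=
  open Classical in (Finset.Icc (-1) 1).filter fun e => v + e ∈ S

theorem mem_steps {n : ℕ} {S : Set (Fin n → ℤ)} {v e : Fin n → ℤ} :
    e ∈ steps S v ↔ e ∈ Finset.Icc (-1) 1 ∧ v + e ∈ S := by
  simp [steps]

/-- The vector `u` is a nonnegative real combination of the vectors in `D`. -/
def IsConeComb {n : ℕ} (D : Finset (Fin n → ℤ)) (u : Fin n → ℝ) : Prop :=
  ∃ l : (Fin n → ℤ) → ℝ, (∀ e, 0 ≤ l e) ∧ u = ∑ e ∈ D, l e • toReal e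

theorem IsConeComb.dotProduct_nonneg {n : ℕ} {D : Finset (Fin n → ℤ)} {u h : Fin n → ℝ}
    (hu : IsConeComb D u) (hD : ∀ e ∈ D, 0 ≤ h ⬝ᵥ toReal e) : 0 ≤ h ⬝ᵥ u := by
  obtain ⟨l, hl, rfl⟩ := hu
  rw [dotProduct_sum]
  refine Finset.sum_nonneg fun e he => ?_
  rw [dotProduct_smul]
  exact mul_nonneg (hl e) (hD e he)

/-- An integrally convex set lies, as seen from `v`, in the cone of the steps from `v`. -/
theorem IsIntegrallyConvexSet.isConeComb_steps {n : ℕ} {S : Set (Fin n → ℤ)}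
    (hS : IsIntegrallyConvexSet S) {u v : Fin n → ℤ} (hv : v ∈ S) (hu : u ∈ S) :
    IsConeComb (steps S v) (toReal u - toReal v) := by
  classical
  -- Shrinking `u - v` by `R` brings `x` within distance less than 1 of `v`. Points of `N(x)` then
  -- differ from `v` by less than 2, hence by at most 1, in each coordinate.
  set R : ℝ := 1 + ‖toReal u - toReal v‖
  have hR : 0 < R := by positivity
  have hRi : 0 < R⁻¹ := inv_pos.2 hR
  have hR1 : R⁻¹ ≤ 1 := inv_le_one_of_one_le₀ (le_add_of_nonneg_right (norm_nonneg _))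
  set x : Fin n → ℝ := toReal v + R⁻¹ • (toReal u - toReal v) with hxdef
  have hx : x ∈ convexHull ℝ (toReal '' S) := by
    have h := (convex_convexHull ℝ (toReal '' S)) (subset_convexHull ℝ _ ⟨v, hv, rfl⟩)
      (subset_convexHull ℝ _ ⟨u, hu, rfl⟩) (sub_nonneg.2 hR1) hRi.le (sub_add_cancel _ _)
    convert h using 1
    rw [hxdef]
    module
  have hx' := (isIntegrallyConvexSet_iff.1 hS).2 x hx
  have hT : S ∩ (intNbhd x : Set (Fin n → ℤ)) = ((intNbhd x).filter (· ∈ S) :) := by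
    ext y
    simp [and_comm]
  rw [hT] at hx'
  obtain ⟨w, hw0, hw1, hwx⟩ := exists_weights_of_mem_convexHull hx'
  set T := (intNbhd x).filter (· ∈ S)
  have hstep : ∀ y ∈ T, y - v ∈ steps S v := by
    intro y hy
    obtain ⟨hyN, hyS⟩ := Finset.mem_filter.1 hy
    rw [mem_steps]
    refine ⟨?_, by simpa using hyS⟩
    have hd : ∀ i, -1 ≤ y i - v i ∧ y i - v i ≤ 1 := by
      intro i
      have h1 := abs_lt.1 ((mem_intNbhd _ _).1 hyN i)
      have h2 : |x i - v i| < 1 := by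
        have e : x i - v i = R⁻¹ * (toReal u - toReal v) i := by
          simp [hxdef, toReal]
        rw [e, abs_mul, abs_of_pos hRi, inv_mul_lt_iff₀ hR, mul_one]
        have := norm_le_pi_norm (toReal u - toReal v) i
        rw [Real.norm_eq_abs] at this
        linarith
      have h2 := abs_lt.1 h2
      have h3 : ((y i - v i : ℤ) : ℝ) < 2 := by push_cast; linarith
      have h4 : -2 < ((y i - v i : ℤ) : ℝ) := by push_cast; linarith
      have h3' : y i - v i < 2 := by exact_mod_cast h3
      have h4' : -2 < y i - v i := by exact_mod_cast h4
      omega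
    rw [Finset.mem_Icc]
    exact ⟨fun i => (hd i).1, fun i => (hd i).2⟩
  have hsum : toReal u - toReal v = ∑ y ∈ T, (R * w y) • toReal (y - v) := by
    have e1 : x - toReal v = ∑ y ∈ T, w y • toReal (y - v) := by
      simp only [toReal_sub, smul_sub, Finset.sum_sub_distrib, ← Finset.sum_smul, hw1, hwx,
        one_smul]
    have e2 : toReal u - toReal v = R • (x - toReal v) := by
      rw [hxdef, add_sub_cancel_left, smul_smul, mul_inv_cancel₀ hR.ne', one_smul]
    rw [e2, e1, Finset.smul_sum]
    simp only [smul_smul]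
  refine ⟨fun e => if v + e ∈ T then R * w (v + e) else 0, fun e => ?_, ?_⟩
  · dsimp only
    split_ifs with h
    · exact mul_nonneg hR.le (hw0 _ h)
    · exact le_rfl
  · rw [hsum]
    have hinj : Set.InjOn (fun y => y - v) (T : Set (Fin n → ℤ)) :=
      fun a _ b _ h => sub_left_injective h
    have himg : T.image (fun y => y - v) ⊆ steps S v := by
      intro e he
      obtain ⟨y, hy, rfl⟩ := Finset.mem_image.1 he
      exact hstep y hy
    rw [← Finset.sum_subset himg, Finset.sum_image hinj]
    · refine Finset.sum_congr rfl fun y hy => ?_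
      simp [hy]
    · intro e _ he
      dsimp only
      rw [if_neg, zero_smul]
      exact fun h => he (Finset.mem_image.2 ⟨v + e, h, by simp⟩)

theorem IsIntegrallyConvexSet.le_of_steps {n : ℕ} {S : Set (Fin n → ℤ)}
    (hS : IsIntegrallyConvexSet S) {u v : Fin n → ℤ} (hv : v ∈ S) (hu : u ∈ S) {h : Fin n → ℝ}
    (hD : ∀ e ∈ steps S v, 0 ≤ h ⬝ᵥ toReal e) : h ⬝ᵥ toReal v ≤ h ⬝ᵥ toReal u := by
  have := (hS.isConeComb_steps hv hu).dotProduct_nonneg hD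
  rw [dotProduct_sub] at this
  linarith

/-- A linear function bounded below on an integrally convex set is minimal at some point of the
set, and this is already visible from the steps at that point. -/
theorem IsIntegrallyConvexSet.exists_steps_nonneg {n : ℕ} {S : Set (Fin n → ℤ)}
    (hS : IsIntegrallyConvexSet S) {h : Fin n → ℝ} {m : ℝ}
    (hm : ∀ u ∈ S, m ≤ h ⬝ᵥ toReal u) :
    ∃ v ∈ S, ∀ e ∈ steps S v, 0 ≤ h ⬝ᵥ toReal e := by
  -- Only finitely many steps exist, so the decreasing ones decrease `h` by more than a fixed `δ`. A
  -- point within `δ` of the infimum then has no decreasing step.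
  have hδ : ∀ᶠ δ : ℝ in 𝓝[>] 0, ∀ e ∈ Finset.Icc (-1 : Fin n → ℤ) 1,
      h ⬝ᵥ toReal e < 0 → h ⬝ᵥ toReal e < -δ := by
    rw [Finset.eventually_all]
    intro e _
    by_cases he : h ⬝ᵥ toReal e < 0
    · filter_upwards [mem_nhdsWithin_of_mem_nhds (Iio_mem_nhds (neg_pos.2 he))] with δ hδ _
      have : δ < -(h ⬝ᵥ toReal e) := hδ
      linarith
    · exact Eventually.of_forall fun δ h0 => absurd h0 he
  obtain ⟨δ, hδ, hδ0⟩ := (hδ.and self_mem_nhdsWithin).exists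
  have hδ0 : 0 < δ := hδ0
  set A : Set ℝ := (fun u => h ⬝ᵥ toReal u) '' S
  have hne : A.Nonempty := hS.1.image _
  have hbdd : BddBelow A := ⟨m, by rintro _ ⟨u, hu, rfl⟩; exact hm u hu⟩
  obtain ⟨_, ⟨v, hv, rfl⟩, hlt⟩ := exists_lt_of_csInf_lt hne (lt_add_of_pos_right (sInf A) hδ0)
  refine ⟨v, hv, fun e he => ?_⟩
  by_contra hneg
  obtain ⟨heI, heS⟩ := mem_steps.1 he
  have h1 := hδ e heI (not_le.1 hneg)
  have h2 : sInf A ≤ h ⬝ᵥ toReal (v + e) := csInf_le hbdd ⟨_, heS, rfl⟩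
  rw [toReal_add, dotProduct_add] at h2
  dsimp only at hlt
  linarith

theorem IsIntegrallyConvexSet.exists_isMinOn {n : ℕ} {S : Set (Fin n → ℤ)}
    (hS : IsIntegrallyConvexSet S) {h : Fin n → ℝ} {m : ℝ}
    (hm : ∀ u ∈ S, m ≤ h ⬝ᵥ toReal u) :
    ∃ v ∈ S, ∀ u ∈ S, h ⬝ᵥ toReal v ≤ h ⬝ᵥ toReal u := by
  obtain ⟨v, hv, hD⟩ := hS.exists_steps_nonneg hm
  exact ⟨v, hv, fun u hu => hS.le_of_steps hv hu hD⟩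

/-! ### Recession directions from Dickson's lemma -/

/-- Every sequence of lattice points of a rational cone has a subsequence that increases with
respect to the cone. -/
theorem exists_subseq_isConeComb_sub {n : ℕ} (D : Finset (Fin n → ℤ)) (a : ℕ → Fin n → ℤ)
    (ha : ∀ k, IsConeComb D (toReal (a k))) :
    ∃ φ : ℕ ↪o ℕ, ∀ i j, i ≤ j → IsConeComb D (toReal (a (φ j)) - toReal (a (φ i))) := by
  choose l hl hal using ha
  -- Dickson's lemma makes the integer parts of the coefficients monotone along a subsequence. The
  -- remainders are bounded lattice vectors, so a further subsequence makes them constant and they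
  -- cancel in differences.
  set N : ℕ → (D → ℕ) := fun k e => ⌊l k e⌋₊ with hN
  obtain ⟨φ, hφ⟩ := (Set.isPWO_of_wellQuasiOrderedLE (Set.univ : Set (D → ℕ))).exists_monotone_subseq
    (f := N) fun _ => trivial
  set r : ℕ → Fin n → ℤ := fun k => a k - ∑ e : D, N k e • (e : Fin n → ℤ) with hr
  have hra : ∀ k i, (r k i : ℝ) = a k i - ∑ e : D, (N k e : ℝ) * ((e : Fin n → ℤ) i : ℝ) := by
    intro k i
    simp [hr, Finset.sum_apply]
  have hrreal : ∀ k i, (r k i : ℝ) = ∑ e : D, Int.fract (l k e) * ((e : Fin n → ℤ) i : ℝ) := by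
    intro k i
    have h1 : (a k i : ℝ) = ∑ e : D, l k e * ((e : Fin n → ℤ) i : ℝ) := by
      have := congrFun (hal k) i
      rw [← Finset.sum_coe_sort] at this
      simpa [toReal, Finset.sum_apply] using this
    rw [hra, h1, ← Finset.sum_sub_distrib]
    refine Finset.sum_congr rfl fun e _ => ?_
    have h3 : (N k e : ℝ) = ⌊l k e⌋ := by
      rw [hN]
      exact natCast_floor_eq_intCast_floor (hl k e)
    rw [h3, Int.fract, sub_mul]
  set B : ℤ := ∑ e : D, ∑ i, |(e : Fin n → ℤ) i|
  have hB : (B : ℝ) = ∑ e : D, ∑ i, |((e : Fin n → ℤ) i : ℝ)| := by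
    simp only [B]
    push_cast
    rfl
  have hrB : ∀ k, r k ∈ Set.Icc (fun _ : Fin n => -B) (fun _ => B) := by
    intro k
    have hi : ∀ i, |r k i| ≤ B := by
      intro i
      have : |(r k i : ℝ)| ≤ B := by
        rw [hrreal]
        refine (Finset.abs_sum_le_sum_abs _ _).trans ?_
        rw [hB]
        refine Finset.sum_le_sum fun e _ => ?_
        rw [abs_mul, abs_of_nonneg (Int.fract_nonneg _)]
        refine (mul_le_of_le_one_left (abs_nonneg _) (Int.fract_lt_one _).le).trans ?_
        exact Finset.single_le_sum (f := fun i => |((e : Fin n → ℤ) i : ℝ)|)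
          (fun _ _ => abs_nonneg _) (Finset.mem_univ i)
      exact_mod_cast this
    exact ⟨fun i => (abs_le.1 (hi i)).1, fun i => (abs_le.1 (hi i)).2⟩
  obtain ⟨ψ, hψ⟩ := ((Set.finite_Icc (fun _ : Fin n => -B) (fun _ => B)).partiallyWellOrderedOn
    (r := Eq)).exists_monotone_subseq (f := fun k => r (φ k)) fun k => hrB _
  refine ⟨ψ.trans φ, fun i j hij => ?_⟩
  have hle : N (φ (ψ i)) ≤ N (φ (ψ j)) := hφ (ψ.monotone hij)
  have heq : r (φ (ψ i)) = r (φ (ψ j)) := hψ i j hij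
  classical
  refine ⟨fun e => if he : e ∈ D then (N (φ (ψ j)) ⟨e, he⟩ : ℝ) - N (φ (ψ i)) ⟨e, he⟩ else 0,
    fun e => ?_, ?_⟩
  · dsimp only
    split_ifs with he
    · exact sub_nonneg.2 (by exact_mod_cast hle ⟨e, he⟩)
    · exact le_rfl
  · rw [← Finset.sum_coe_sort]
    funext i'
    have h := congrArg (fun z : ℤ => (z : ℝ)) (congrFun heq i')
    simp only [hra] at h
    simp only [toReal, RelEmbedding.coe_trans, Function.comp_apply, Pi.sub_apply,
      Finset.coe_mem, dite_true, Finset.sum_apply, Pi.smul_apply, smul_eq_mul, sub_mul,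
      Finset.sum_sub_distrib]
    linarith

/-- Subsequences are refined one cone at a time. The apex `w` may depend on the cone because it
cancels in differences. -/
theorem exists_common_subseq_isConeComb_sub {n : ℕ} (𝒟 : Finset (Finset (Fin n → ℤ)))
    (u : ℕ → Fin n → ℤ)
    (hu : ∀ D ∈ 𝒟, ∃ w : Fin n → ℤ, ∀ k, IsConeComb D (toReal (u k) - toReal w)) :
    ∃ φ : ℕ ↪o ℕ, ∀ D ∈ 𝒟, ∀ i j, i ≤ j →
      IsConeComb D (toReal (u (φ j)) - toReal (u (φ i))) := by
  classical
  induction 𝒟 using Finset.induction_on with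
  | empty => exact ⟨RelEmbedding.refl _, by simp⟩
  | insert D 𝒟 _ ih =>
    obtain ⟨φ, hφ⟩ := ih fun D' hD' => hu D' (Finset.mem_insert_of_mem hD')
    obtain ⟨w, hw⟩ := hu D (Finset.mem_insert_self _ _)
    obtain ⟨ψ, hψ⟩ := exists_subseq_isConeComb_sub D (fun k => u (φ k) - w) fun k => by
      rw [toReal_sub]
      exact hw _
    refine ⟨ψ.trans φ, fun D' hD' i j hij => ?_⟩
    rcases Finset.mem_insert.1 hD' with rfl | hD'
    · simpa [toReal_sub] using hψ i j hij
    · exact hφ D' hD' _ _ (ψ.monotone hij)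

/-- Among the points of a sequence in an integrally convex set there are two whose difference is
a recession direction: every linear function bounded below on the set is nonnegative on it. -/
theorem IsIntegrallyConvexSet.exists_recession_sub {n : ℕ} {S : Set (Fin n → ℤ)}
    (hS : IsIntegrallyConvexSet S) (u : ℕ → Fin n → ℤ) (hu : ∀ k, u k ∈ S) :
    ∃ i j, i < j ∧ ∀ (h : Fin n → ℝ) (m : ℝ), (∀ y ∈ S, m ≤ h ⬝ᵥ toReal y) →
      0 ≤ h ⬝ᵥ toReal (u j - u i) := by
  classical
  obtain ⟨φ, hφ⟩ := exists_common_subseq_isConeComb_sub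
    ((Finset.Icc (-1) 1).powerset.filter fun D => ∃ w ∈ S, steps S w = D) u (by
      intro D hD
      obtain ⟨w, hw, rfl⟩ := (Finset.mem_filter.1 hD).2
      exact ⟨w, fun k => hS.isConeComb_steps hw (hu k)⟩)
  -- The chosen difference lies in every step cone of `S`, in particular in the one at a minimizer
  -- of `h`.
  refine ⟨φ 0, φ 1, φ.strictMono one_pos, fun h m hm => ?_⟩
  obtain ⟨v, hv, hD⟩ := hS.exists_steps_nonneg hm
  rw [toReal_sub]
  refine (hφ (steps S v) ?_ 0 1 zero_le_one).dotProduct_nonneg hD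
  refine Finset.mem_filter.2 ⟨Finset.mem_powerset.2 fun e he => (mem_steps.1 he).1, v, hv, rfl⟩

/-! ### Perturbation of affine functions on an integrally convex set -/

/-- Perturbation of an affine function `g` that is nonnegative on an integrally convex set: if
`b` is positive where `g` vanishes, and nonnegative on the lattice recession directions along
which `g` is constant, then `g + ε b` is bounded below by a positive constant for small `ε`. -/
theorem IsIntegrallyConvexSet.eventually_pos_perturbation {n : ℕ} {S : Set (Fin n → ℤ)}
    (hS : IsIntegrallyConvexSet S) {c b : Fin n → ℝ} {κ β : ℝ}
    (hg : ∀ u ∈ S, 0 ≤ c ⬝ᵥ toReal u + κ)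
    (hb : ∀ u ∈ S, c ⬝ᵥ toReal u + κ = 0 → 0 < b ⬝ᵥ toReal u + β)
    (hrec : ∀ r : Fin n → ℤ, (∀ (h : Fin n → ℝ) (m : ℝ), (∀ y ∈ S, m ≤ h ⬝ᵥ toReal y) →
      0 ≤ h ⬝ᵥ toReal r) → c ⬝ᵥ toReal r = 0 → 0 ≤ b ⬝ᵥ toReal r) :
    ∀ᶠ ε : ℝ in 𝓝[>] 0, ∃ m : ℝ, 0 < m ∧ ∀ u ∈ S,
      m ≤ (c ⬝ᵥ toReal u + κ) + ε * (b ⬝ᵥ toReal u + β) := by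
  obtain ⟨v₀, hv₀, hmin⟩ := hS.exists_isMinOn (h := c) (m := -κ) fun u hu => by
    linarith [hg u hu]
  -- Here `v` is a lexicographic minimizer, first for `c` and then for `b`. For small `ε` no step
  -- from `v` decreases `c + ε • b`, so `v` also minimizes that function on `S`.
  obtain ⟨v, hv, hcv, hbv⟩ : ∃ v ∈ S, c ⬝ᵥ toReal v = c ⬝ᵥ toReal v₀ ∧
      ∀ u ∈ S, c ⬝ᵥ toReal u = c ⬝ᵥ toReal v₀ → b ⬝ᵥ toReal v ≤ b ⬝ᵥ toReal u := by
    by_contra! H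
    let M := {u : Fin n → ℤ // u ∈ S ∧ c ⬝ᵥ toReal u = c ⬝ᵥ toReal v₀}
    have hnext : ∀ v : M, ∃ u : M, b ⬝ᵥ toReal u.1 < b ⬝ᵥ toReal v.1 := fun v => by
      obtain ⟨u, hu, hcu, hlt⟩ := H v.1 v.2.1 v.2.2
      exact ⟨⟨u, hu, hcu⟩, hlt⟩
    choose next hlt using hnext
    let s : ℕ → M := fun k => next^[k] ⟨v₀, hv₀, rfl⟩
    have hanti : StrictAnti fun k => b ⬝ᵥ toReal (s k).1 := strictAnti_nat_of_succ_lt fun k => by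
      simp only [s, Function.iterate_succ_apply']
      exact hlt _
    obtain ⟨i, j, hij, hr⟩ := hS.exists_recession_sub (fun k => (s k).1) fun k => (s k).2.1
    have h1 := hrec _ hr (by
      rw [toReal_sub, dotProduct_sub, (s i).2.2, (s j).2.2, sub_self])
    rw [toReal_sub, dotProduct_sub] at h1
    have h2 : b ⬝ᵥ toReal (s j).1 < b ⬝ᵥ toReal (s i).1 := hanti hij
    linarith
  have hpert : ∀ A B : ℝ, 0 ≤ A → (A = 0 → 0 < B) → ∀ᶠ ε : ℝ in 𝓝[>] 0, 0 < A + ε * B := by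
    intro A B hA hB
    rcases hA.eq_or_lt with hA | hA
    · filter_upwards [self_mem_nhdsWithin] with ε hε
      rw [← hA, zero_add]
      exact mul_pos hε (hB hA.symm)
    · have hcont : Tendsto (fun ε : ℝ => A + ε * B) (𝓝 0) (𝓝 (A + 0 * B)) :=
        Continuous.tendsto (by fun_prop) 0
      rw [zero_mul, add_zero] at hcont
      exact (hcont.mono_left nhdsWithin_le_nhds).eventually_const_lt hA
  have hstep : ∀ᶠ ε : ℝ in 𝓝[>] 0, ∀ e ∈ steps S v, 0 ≤ (c + ε • b) ⬝ᵥ toReal e := by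
    rw [Finset.eventually_all]
    intro e he
    have heS := (mem_steps.1 he).2
    have hce : 0 ≤ c ⬝ᵥ toReal e := by
      have := hmin _ heS
      rw [toReal_add, dotProduct_add] at this
      linarith
    simp only [add_dotProduct, smul_dotProduct, smul_eq_mul]
    by_cases hbe : 0 ≤ b ⬝ᵥ toReal e
    · filter_upwards [self_mem_nhdsWithin] with ε hε
      exact add_nonneg hce (mul_nonneg (le_of_lt hε) hbe)
    · refine (hpert _ (b ⬝ᵥ toReal e) hce fun h0 => absurd ?_ hbe).mono fun ε h => h.le
      have := hbv _ heS (by rw [toReal_add, dotProduct_add, h0, add_zero, hcv])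
      rw [toReal_add, dotProduct_add] at this
      linarith
  filter_upwards [hstep, hpert _ _ (hg v hv) (hb v hv)] with ε hε hpos
  refine ⟨_, hpos, fun u hu => ?_⟩
  have := hS.le_of_steps hv hu hε
  simp only [add_dotProduct, smul_dotProduct, smul_eq_mul] at this
  linarith

/-! ### Minorants, contact sets and the two extensions -/

/-- The affine function `x ↦ ⟨p, x⟩ + α` minorizes `f`. -/
def IsMinorant {n : ℕ} (f : (Fin n → ℤ) → EReal) (p : Fin n → ℝ) (α : ℝ) : Prop :=
  ∀ y : Fin n → ℤ, ((p ⬝ᵥ toReal y + α : ℝ) : EReal) ≤ f y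

/-- The set of lattice points at which `f` agrees with the affine function `x ↦ ⟨p, x⟩ + α`. -/
def contactSet {n : ℕ} (f : (Fin n → ℤ) → EReal) (p : Fin n → ℝ) (α : ℝ) : Set (Fin n → ℤ) :=
  {z | f z = ((p ⬝ᵥ toReal z + α : ℝ) : EReal)}

theorem coe_le_sub_coe_iff (t : EReal) (a b : ℝ) :
    (b : EReal) ≤ t - (a : EReal) ↔ ((a + b : ℝ) : EReal) ≤ t := by
  induction t using EReal.rec with
  | bot => simp [-EReal.coe_add]
  | top => simp [-EReal.coe_add]
  | coe r =>
    rw [← EReal.coe_sub, EReal.coe_le_coe_iff, EReal.coe_le_coe_iff, le_sub_iff_add_le']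

theorem sub_coe_eq_coe_iff (t : EReal) (a b : ℝ) :
    t - (a : EReal) = (b : EReal) ↔ t = ((a + b : ℝ) : EReal) := by
  induction t using EReal.rec with
  | bot => simp [-EReal.coe_add]
  | top => simp [-EReal.coe_add]
  | coe r =>
    rw [← EReal.coe_sub, EReal.coe_eq_coe_iff, EReal.coe_eq_coe_iff, sub_eq_iff_eq_add']

/-- A minorant of slope `p` that touches `f` says precisely that `α` is the attained minimum of
`f[-p]`. -/
theorem IsMinorant.argmin_tilt {n : ℕ} {f : (Fin n → ℤ) → EReal} {p : Fin n → ℝ} {α : ℝ}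
    (hp : IsMinorant f p α) (hne : (contactSet f p α).Nonempty) :
    argmin (tilt f p) = contactSet f p α ∧ AttainsFiniteMin (tilt f p) := by
  obtain ⟨z, hz⟩ := hne
  have hle : ∀ y, (α : EReal) ≤ tilt f p y := fun y => (coe_le_sub_coe_iff _ _ _).2 (hp y)
  have heq : ∀ y, tilt f p y = α ↔ y ∈ contactSet f p α := fun y => sub_coe_eq_coe_iff _ _ _
  have harg : argmin (tilt f p) = contactSet f p α := by
    ext y
    rw [← heq]
    constructor
    · exact fun h => le_antisymm ((h z).trans_eq ((heq z).2 hz)) (hle y)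
    · exact fun h x => h.trans_le (hle x)
  refine ⟨harg, z, harg ▸ hz, ?_⟩
  rw [(heq z).2 hz]
  exact ⟨EReal.coe_ne_bot _, EReal.coe_ne_top _⟩

theorem AttainsFiniteMin.exists_isMinorant {n : ℕ} {f : (Fin n → ℤ) → EReal} {p : Fin n → ℝ}
    (h : AttainsFiniteMin (tilt f p)) :
    ∃ α : ℝ, IsMinorant f p α ∧ (contactSet f p α).Nonempty := by
  obtain ⟨z, hz, hb, ht⟩ := h
  lift tilt f p z to ℝ using ⟨ht, hb⟩ with α hα
  refine ⟨α, fun y => (coe_le_sub_coe_iff _ _ _).1 (hα.trans_le (hz y)), z, ?_⟩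
  exact (sub_coe_eq_coe_iff _ _ _).1 hα.symm

theorem IsMinorant.le_convexEnvelope {n : ℕ} {f : (Fin n → ℤ) → EReal} {p : Fin n → ℝ} {α : ℝ}
    (hp : IsMinorant f p α) (x : Fin n → ℝ) :
    ((p ⬝ᵥ x + α : ℝ) : EReal) ≤ convexEnvelope f x :=
  le_iSup_of_le p <| le_iSup_of_le α <| le_iSup_of_le hp le_rfl

theorem convexEnvelope_le {n : ℕ} {f : (Fin n → ℤ) → EReal} {x : Fin n → ℝ} {t : EReal}
    (h : ∀ p α, IsMinorant f p α → ((p ⬝ᵥ x + α : ℝ) : EReal) ≤ t) : convexEnvelope f x ≤ t :=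
  iSup_le fun p => iSup_le fun α => iSup_le fun hp => h p α hp

theorem sum_mul_affine {n : ℕ} {T : Finset (Fin n → ℤ)} {w : (Fin n → ℤ) → ℝ} {x : Fin n → ℝ}
    (hw1 : ∑ y ∈ T, w y = 1) (hwx : ∑ y ∈ T, w y • toReal y = x) (p : Fin n → ℝ) (α : ℝ) :
    ∑ y ∈ T, (w y : EReal) * ((p ⬝ᵥ toReal y + α : ℝ) : EReal) =
      ((p ⬝ᵥ x + α : ℝ) : EReal) := by
  have h : ∑ y ∈ T, w y * (p ⬝ᵥ toReal y + α) = p ⬝ᵥ x + α := by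
    simp only [mul_add, Finset.sum_add_distrib, ← Finset.sum_mul, hw1, one_mul, ← hwx,
      dotProduct_sum, dotProduct_smul, smul_eq_mul]
  rw [← h]
  simp only [← EReal.coe_mul]
  exact (map_sum (⟨⟨Real.toEReal, EReal.coe_zero⟩, EReal.coe_add⟩ : ℝ →+ EReal) _ _).symm

/-- An affine function that minorizes `f` on `N(x)` minorizes the local convex extension at `x`. -/
theorem le_localConvexExtension {n : ℕ} {f : (Fin n → ℤ) → EReal} {p x : Fin n → ℝ} {α : ℝ}
    (hp : ∀ y ∈ intNbhd x, ((p ⬝ᵥ toReal y + α : ℝ) : EReal) ≤ f y) :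
    ((p ⬝ᵥ x + α : ℝ) : EReal) ≤ localConvexExtension f x := by
  refine le_sInf ?_
  rintro _ ⟨w, hw0, hw1, hwx, rfl⟩
  rw [← sum_mul_affine hw1 hwx]
  exact Finset.sum_le_sum fun y hy =>
    mul_le_mul_of_nonneg_left (hp y hy) (EReal.coe_nonneg.2 (hw0 y hy))

theorem convexEnvelope_le_localConvexExtension {n : ℕ} (f : (Fin n → ℤ) → EReal)
    (x : Fin n → ℝ) : convexEnvelope f x ≤ localConvexExtension f x :=
  convexEnvelope_le fun _ _ hp => le_localConvexExtension fun y _ => hp y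

theorem localConvexExtension_le {n : ℕ} {f : (Fin n → ℤ) → EReal} {p x : Fin n → ℝ} {α : ℝ}
    (hx : x ∈ convexHull ℝ
      (toReal '' (contactSet f p α ∩ (intNbhd x : Set (Fin n → ℤ))))) :
    localConvexExtension f x ≤ ((p ⬝ᵥ x + α : ℝ) : EReal) := by
  classical
  have hT : contactSet f p α ∩ (intNbhd x : Set (Fin n → ℤ)) =
      ((intNbhd x).filter (· ∈ contactSet f p α) :) := by
    ext y
    simp [and_comm]
  rw [hT] at hx
  obtain ⟨w, hw0, hw1, hwx⟩ := exists_weights_of_mem_convexHull hx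
  set T := (intNbhd x).filter (· ∈ contactSet f p α)
  have hTsub : T ⊆ intNbhd x := Finset.filter_subset _ _
  -- Extension by zero is harmless even where `f` is `⊤`, since `0 * ⊤ = 0` in `EReal`.
  obtain ⟨w', hin, hout⟩ : ∃ w' : (Fin n → ℤ) → ℝ, (∀ y ∈ T, w' y = w y) ∧ ∀ y ∉ T, w' y = 0 :=
    ⟨fun y => if y ∈ T then w y else 0, fun y hy => if_pos hy, fun y hy => if_neg hy⟩
  refine sInf_le ⟨w', fun y _ => ?_, ?_, ?_, ?_⟩
  · by_cases hy : y ∈ T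
    · exact (hw0 y hy).trans_eq (hin y hy).symm
    · exact (hout y hy).ge
  · rw [← Finset.sum_subset hTsub fun y _ hy => hout y hy, Finset.sum_congr rfl hin, hw1]
  · rw [← Finset.sum_subset hTsub fun y _ hy => by rw [hout y hy, zero_smul],
      Finset.sum_congr rfl fun y hy => by rw [hin y hy], hwx]
  · rw [← Finset.sum_subset hTsub fun y _ hy => by rw [hout y hy, EReal.coe_zero, zero_mul],
      ← sum_mul_affine hw1 hwx]
    refine Finset.sum_congr rfl fun y hy => ?_
    rw [hin y hy, show f y = _ from (Finset.mem_filter.1 hy).2]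

theorem localConvexExtension_toReal_le {n : ℕ} {f : (Fin n → ℤ) → EReal} {p : Fin n → ℝ} {α : ℝ}
    {z : Fin n → ℤ} (hz : z ∈ contactSet f p α) :
    localConvexExtension f (toReal z) ≤ ((p ⬝ᵥ toReal z + α : ℝ) : EReal) :=
  localConvexExtension_le
    (subset_convexHull ℝ _ ⟨z, ⟨hz, self_mem_intNbhd z⟩, rfl⟩)

/-! ### Convex local extension implies integrally convex contact sets -/

theorem exists_dotProduct_separation {n : ℕ} {C : Set (Fin n → ℝ)} (hC : Convex ℝ C)
    (hcl : IsClosed C) {x : Fin n → ℝ} (hx : x ∉ C) :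
    ∃ (b : Fin n → ℝ) (s : ℝ), (∀ y ∈ C, b ⬝ᵥ y < s) ∧ s < b ⬝ᵥ x := by
  obtain ⟨φ, s, h1, h2⟩ := geometric_hahn_banach_closed_point hC hcl hx
  have hφ : ∀ y, φ y = (fun i => φ (Pi.single i 1)) ⬝ᵥ y := by
    intro y
    conv_lhs => rw [pi_eq_sum_univ' y]
    simp [dotProduct, mul_comm]
  exact ⟨_, s, fun y hy => hφ y ▸ h1 y hy, hφ x ▸ h2⟩

/-- If the local convex extension is convex, the contact sets are integrally convex. -/
theorem IsIntegrallyConvexFun.isIntegrallyConvexSet_contactSet {n : ℕ}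
    {f : (Fin n → ℤ) → EReal} (hf : IsIntegrallyConvexFun f) {p : Fin n → ℝ} {α : ℝ}
    (hp : IsMinorant f p α) (hne : (contactSet f p α).Nonempty) :
    IsIntegrallyConvexSet (contactSet f p α) := by
  refine isIntegrallyConvexSet_iff.2 ⟨hne, fun x hx => ?_⟩
  have hle : localConvexExtension f x ≤ ((p ⬝ᵥ x + α : ℝ) : EReal) := by
    have hconv : Convex ℝ
        {y : Fin n → ℝ | localConvexExtension f y ≤ ((p ⬝ᵥ y + α : ℝ) : EReal)} := by
      intro y hy z hz a b ha hb hab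
      have h := hf (x := (y, p ⬝ᵥ y + α)) hy (y := (z, p ⬝ᵥ z + α)) hz ha hb hab
      have e : a * (p ⬝ᵥ y + α) + b * (p ⬝ᵥ z + α) = p ⬝ᵥ (a • y + b • z) + α := by
        rw [dotProduct_add, dotProduct_smul, dotProduct_smul, smul_eq_mul, smul_eq_mul]
        linear_combination α * hab
      rw [Set.mem_ofPred_eq, ← e]
      exact h
    refine convexHull_min ?_ hconv hx
    rintro _ ⟨z, hz, rfl⟩
    exact localConvexExtension_toReal_le hz
  by_contra hnot
  have hfin : (toReal '' (contactSet f p α ∩ (intNbhd x : Set (Fin n → ℤ)))).Finite :=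
    ((intNbhd x).finite_toSet.inter_of_right _).image _
  obtain ⟨b, s, hbs, hsx⟩ := exists_dotProduct_separation (convex_convexHull ℝ _)
    (hfin.isCompact_convexHull ℝ).isClosed hnot
  -- The tilt lowers the minorant at contact points of `N(x)`. At the finitely many other points
  -- there is strict slack to absorb a small `ε`.
  have hev : ∀ᶠ ε : ℝ in 𝓝[>] 0, ∀ y ∈ intNbhd x,
      (((p ⬝ᵥ toReal y + α) + ε * (b ⬝ᵥ toReal y - s) : ℝ) : EReal) ≤ f y := by
    rw [Finset.eventually_all]
    intro y hy
    by_cases hyc : y ∈ contactSet f p α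
    · have hby : b ⬝ᵥ toReal y < s := hbs _ (subset_convexHull ℝ _ ⟨y, ⟨hyc, hy⟩, rfl⟩)
      filter_upwards [self_mem_nhdsWithin] with ε hε
      rw [show f y = _ from hyc, EReal.coe_le_coe_iff]
      have : ε * (b ⬝ᵥ toReal y - s) ≤ 0 :=
        mul_nonpos_of_nonneg_of_nonpos (le_of_lt hε) (by linarith)
      linarith
    · have hlt := lt_of_le_of_ne (hp y) (Ne.symm hyc)
      obtain ⟨t, ht1, ht2⟩ := EReal.lt_iff_exists_real_btwn.1 hlt
      rw [EReal.coe_lt_coe_iff] at ht1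
      have hcont : Tendsto (fun ε : ℝ => (p ⬝ᵥ toReal y + α) + ε * (b ⬝ᵥ toReal y - s)) (𝓝 0)
          (𝓝 ((p ⬝ᵥ toReal y + α) + 0 * (b ⬝ᵥ toReal y - s))) :=
        Continuous.tendsto (by fun_prop) 0
      rw [zero_mul, add_zero] at hcont
      filter_upwards [(hcont.mono_left nhdsWithin_le_nhds).eventually_lt_const ht1] with ε hε
      exact (EReal.coe_le_coe_iff.2 hε.le).trans ht2.le
  obtain ⟨ε, hε, hε0⟩ := (hev.and self_mem_nhdsWithin).exists
  have hle' := (le_localConvexExtension (f := f) (p := p + ε • b) (α := α - ε * s)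
    fun y hy => ?_).trans hle
  · rw [EReal.coe_le_coe_iff, add_dotProduct, smul_dotProduct, smul_eq_mul] at hle'
    have : 0 < ε * (b ⬝ᵥ x - s) := mul_pos hε0 (by linarith)
    linarith
  · convert hε y hy using 2
    rw [add_dotProduct, smul_dotProduct, smul_eq_mul]
    ring

/-! ### Affine pieces of a polyhedral envelope -/

theorem IsPolyhedralConvexFun.isConvexFun {n : ℕ} {g : (Fin n → ℝ) → EReal}
    (hg : IsPolyhedralConvexFun g) : IsConvexFun g := by
  obtain ⟨m, a, b, c, h⟩ := hg
  rw [IsConvexFun, h]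
  intro x hx y hy s t hs ht hst k
  have h1 := mul_le_mul_of_nonneg_left (hx k) hs
  have h2 := mul_le_mul_of_nonneg_left (hy k) ht
  simp only [Prod.fst_add, Prod.snd_add, Prod.smul_fst, Prod.smul_snd, dotProduct_add,
    dotProduct_smul, smul_eq_mul]
  linear_combination h1 + h2 + c k * hst

/-- A polyhedral convex envelope is, on its effective domain, the maximum of finitely many affine
minorants. -/
theorem exists_affine_pieces {n : ℕ} {f : (Fin n → ℤ) → EReal} (hf : ∀ x, f x ≠ ⊥)
    (hpoly : IsPolyhedralConvexFun (convexEnvelope f))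
    (hext : ∀ x : Fin n → ℤ, convexEnvelope f (toReal x) = f x) :
    ∃ (m : ℕ) (I : Set (Fin m)) (q : I → Fin n → ℝ) (α : I → ℝ),
      (∀ k, IsMinorant f (q k) (α k)) ∧
      ∀ x, convexEnvelope f x ≠ ⊤ → ∃ k, convexEnvelope f x = ((q k ⬝ᵥ x + α k : ℝ) : EReal) := by
  obtain ⟨m, a, b, c, hepi⟩ := hpoly
  have hmem : ∀ (x : Fin n → ℝ) (t : ℝ),
      convexEnvelope f x ≤ t ↔ ∀ k, a k ⬝ᵥ x + b k * t ≤ c k := fun x t =>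
    Set.ext_iff.1 hepi (x, t)
  -- A value `⊥` at one point would mean that there are no minorants, forcing `f 0 = ⊥`.
  have hbot : ∀ x, convexEnvelope f x ≠ ⊥ := by
    intro x hx
    refine hf 0 ?_
    rw [← hext, eq_bot_iff]
    exact convexEnvelope_le fun p α hp => absurd (hx ▸ hp.le_convexEnvelope x)
      (not_le.2 (EReal.bot_lt_coe _))
  have haff : ∀ k (x : Fin n → ℝ), (-(b k)⁻¹ • a k) ⬝ᵥ x + c k / b k =
      (c k - a k ⬝ᵥ x) / b k := by
    intro k x
    rw [smul_dotProduct, smul_eq_mul]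
    ring
  refine ⟨m, {k | b k < 0}, fun k => -(b k)⁻¹ • a k, fun k => c k / b k, fun k y => ?_,
    fun x hx => ?_⟩
  · by_cases hy : f y = ⊤
    · rw [hy]
      exact le_top
    · lift f y to ℝ using ⟨hy, hf y⟩ with t ht
      have h := (hmem (toReal y) t).1 (by rw [hext, ht]) k
      rw [EReal.coe_le_coe_iff, haff, div_le_iff_of_neg k.2]
      linarith
  · lift convexEnvelope f x to ℝ using ⟨hx, hbot x⟩ with t ht
    have hxt := (hmem x t).1 ht.ge
    -- The epigraph is closed upwards. With `b k > 0`, the height chosen below would exceed `c k` by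
    -- exactly 1.
    have hb : ∀ k, b k ≤ 0 := by
      intro k
      by_contra hpos
      rw [not_le] at hpos
      have h := (hmem x (t + (c k - (a k ⬝ᵥ x + b k * t) + 1) / b k)).1 (by
        rw [← ht, EReal.coe_le_coe_iff]
        exact le_add_of_nonneg_right (div_nonneg (by linarith [hxt k]) hpos.le)) k
      rw [mul_add, mul_div_cancel₀ _ hpos.ne'] at h
      linarith
    by_contra! H
    -- If no non-vertical inequality is tight at `(x, t)`, the point can be lowered within the
    -- epigraph; vertical ones ignore the height.
    have hev : ∀ᶠ ε : ℝ in 𝓝[>] 0, ∀ k, a k ⬝ᵥ x + b k * (t - ε) ≤ c k := by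
      rw [eventually_all]
      intro k
      rcases (hb k).eq_or_lt with h0 | h0
      · refine Eventually.of_forall fun ε => ?_
        have := hxt k
        rw [h0] at this ⊢
        linarith
      · have hne : a k ⬝ᵥ x + b k * t ≠ c k := by
          intro h
          refine H ⟨k, h0⟩ ?_
          rw [EReal.coe_eq_coe_iff, haff, eq_div_iff h0.ne]
          linarith
        have hlt := lt_of_le_of_ne (hxt k) hne
        have hcont : Tendsto (fun ε : ℝ => a k ⬝ᵥ x + b k * (t - ε)) (𝓝 0)
            (𝓝 (a k ⬝ᵥ x + b k * (t - 0))) := Continuous.tendsto (by fun_prop) 0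
        rw [sub_zero] at hcont
        exact ((hcont.mono_left nhdsWithin_le_nhds).eventually_lt_const hlt).mono
          fun ε h => h.le
    obtain ⟨ε, hε, hε0⟩ := (hev.and self_mem_nhdsWithin).exists
    have h := (hmem x (t - ε)).2 hε
    rw [← ht, EReal.coe_le_coe_iff] at h
    have hε0 : 0 < ε := hε0
    linarith

/-! ### Integrally convex contact sets imply convex local extension -/

/-- Translation of a contact set along a recession direction of another contact set along which
the two affine functions agree. -/
theorem IsMinorant.add_mem_contactSet {n : ℕ} {f : (Fin n → ℤ) → EReal}
    (hext : ∀ x : Fin n → ℤ, convexEnvelope f (toReal x) = f x) {p q : Fin n → ℝ} {α κ : ℝ}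
    (hp : IsMinorant f p α) {r : Fin n → ℤ}
    (hr : ∀ (h : Fin n → ℝ) (m : ℝ), (∀ y ∈ contactSet f q κ, m ≤ h ⬝ᵥ toReal y) →
      0 ≤ h ⬝ᵥ toReal r)
    (hpq : (q - p) ⬝ᵥ toReal r = 0) {u : Fin n → ℤ} (hu : u ∈ contactSet f p α) :
    u + r ∈ contactSet f p α := by
  refine le_antisymm ?_ (hp _)
  rw [← hext]
  refine convexEnvelope_le fun h a ha => ?_
  have h1 : h ⬝ᵥ toReal u + a ≤ p ⬝ᵥ toReal u + α :=
    EReal.coe_le_coe_iff.1 ((ha u).trans_eq hu)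
  -- Since `q - h` is bounded below on the contact set of `q`, every minorant slope `h` grows along
  -- `r` at most as fast as `q`, hence as `p`. Taking the supremum over minorants bounds `f (u +
  -- r)`.
  have h2 := hr (q - h) (a - κ) fun y hy => by
    have : h ⬝ᵥ toReal y + a ≤ q ⬝ᵥ toReal y + κ := EReal.coe_le_coe_iff.1 ((ha y).trans_eq hy)
    rw [sub_dotProduct]
    linarith
  rw [sub_dotProduct] at h2 hpq
  rw [EReal.coe_le_coe_iff, toReal_add, dotProduct_add, dotProduct_add]
  linarith

/-- If all nonempty contact sets are integrally convex, then every point at which the envelope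
agrees with an affine minorant lies in the convex hull of the contact set of that minorant. -/
theorem mem_convexHull_contactSet {n : ℕ} {f : (Fin n → ℤ) → EReal} (hf : ∀ x, f x ≠ ⊥)
    (hpoly : IsPolyhedralConvexFun (convexEnvelope f))
    (hext : ∀ x : Fin n → ℤ, convexEnvelope f (toReal x) = f x)
    (hIC : ∀ p α, IsMinorant f p α → (contactSet f p α).Nonempty →
      IsIntegrallyConvexSet (contactSet f p α))
    {p x : Fin n → ℝ} {α : ℝ} (hp : IsMinorant f p α)
    (hx : convexEnvelope f x = ((p ⬝ᵥ x + α : ℝ) : EReal)) :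
    x ∈ convexHull ℝ (toReal '' contactSet f p α) := by
  by_contra hnot
  obtain ⟨b, s, hbs, hsx, hb0⟩ : ∃ (b : Fin n → ℝ) (s : ℝ),
      (∀ u ∈ contactSet f p α, b ⬝ᵥ toReal u < s) ∧ s < b ⬝ᵥ x ∧
      (contactSet f p α = ∅ → b = 0) := by
    rcases (contactSet f p α).eq_empty_or_nonempty with he | hne
    -- With no contact at all, the tilt becomes a pure upward shift by `ε`.
    · exact ⟨0, -1, by simp [he], by simp, fun _ => rfl⟩
    · obtain ⟨b, s, h1, h2⟩ := exists_dotProduct_separation (convex_convexHull ℝ _)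
        (hIC p α hp hne).isClosed_convexHull hnot
      exact ⟨b, s, fun u hu => h1 _ (subset_convexHull ℝ _ ⟨u, hu, rfl⟩), h2,
        fun he => absurd he hne.ne_empty⟩
  obtain ⟨M, I, q, κ, hq, hcover⟩ := exists_affine_pieces hf hpoly hext
  have hev : ∀ᶠ ε : ℝ in 𝓝[>] 0, ∀ k, ∃ m : ℝ, 0 < m ∧ ∀ u ∈ contactSet f (q k) (κ k),
      m ≤ ((q k - p) ⬝ᵥ toReal u + (κ k - α)) + ε * ((-b) ⬝ᵥ toReal u + s) := by
    rw [eventually_all]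
    intro k
    rcases (contactSet f (q k) (κ k)).eq_empty_or_nonempty with he | hne
    · exact Eventually.of_forall fun ε => ⟨1, one_pos, by simp [he]⟩
    refine (hIC _ _ (hq k) hne).eventually_pos_perturbation (fun u hu => ?_)
      (fun u hu h0 => ?_) fun r hr h0 => ?_
    · have : p ⬝ᵥ toReal u + α ≤ q k ⬝ᵥ toReal u + κ k :=
        EReal.coe_le_coe_iff.1 ((hp u).trans_eq hu)
      rw [sub_dotProduct]
      linarith
    · rw [sub_dotProduct] at h0
      have hup : u ∈ contactSet f p α := by
        rw [contactSet, Set.mem_ofPred_eq, show f u = _ from hu, EReal.coe_eq_coe_iff]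
        linarith
      rw [neg_dotProduct]
      linarith [hbs u hup]
    · rcases (contactSet f p α).eq_empty_or_nonempty with he | ⟨v, hv⟩
      · simp [hb0 he]
      by_contra hneg
      rw [neg_dotProduct, neg_nonneg, not_le] at hneg
      -- Translates of `v` by multiples of `r` stay in the contact set, so `b` increasing along `r`
      -- would violate the separating bound `s`.
      have hiter : ∀ j : ℕ, v + j • r ∈ contactSet f p α := by
        intro j
        induction j with
        | zero => simpa using hv
        | succ j ih =>
          rw [succ_nsmul, ← add_assoc]
          exact hp.add_mem_contactSet hext hr h0 ih
      obtain ⟨j, hj⟩ := exists_nat_gt ((s - b ⬝ᵥ toReal v) / (b ⬝ᵥ toReal r))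
      rw [div_lt_iff₀ hneg] at hj
      have h1 := hbs _ (hiter j)
      have h2 : toReal (j • r) = (j : ℝ) • toReal r := by
        funext i
        simp [toReal]
      rw [toReal_add, h2, dotProduct_add, dotProduct_smul, smul_eq_mul] at h1
      linarith
  obtain ⟨ε, hε, hε0⟩ := (hev.and self_mem_nhdsWithin).exists
  have hε0 : 0 < ε := hε0
  choose m hm0 hm using hε
  have hmin : ∀ᶠ δ : ℝ in 𝓝[>] 0, ∀ k, δ < m k := by
    rw [eventually_all]
    exact fun k => mem_nhdsWithin_of_mem_nhds (Iio_mem_nhds (hm0 k))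
  obtain ⟨δ, hδ, hδ0⟩ := (hmin.and self_mem_nhdsWithin).exists
  have hδ0 : 0 < δ := hδ0
  -- This affine function exceeds the old one by `ε * (b ⬝ᵥ u - s) + δ` at `u`. Where `f` is finite
  -- it coincides with some piece, whose gap to the old minorant covers this excess by the choice of
  -- `m k`.
  have hminor : IsMinorant f (p + ε • b) (α + δ - ε * s) := by
    intro u
    by_cases hu : f u = ⊤
    · rw [hu]
      exact le_top
    · obtain ⟨k, hk⟩ := hcover (toReal u) (by rwa [hext])
      rw [hext] at hk
      have h := hm k u hk
      rw [hk, EReal.coe_le_coe_iff, add_dotProduct, smul_dotProduct, smul_eq_mul]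
      rw [sub_dotProduct, neg_dotProduct] at h
      linarith [hδ k]
  have h := hminor.le_convexEnvelope x
  rw [hx, EReal.coe_le_coe_iff, add_dotProduct, smul_dotProduct, smul_eq_mul] at h
  have : 0 < ε * (b ⬝ᵥ x - s) := mul_pos hε0 (by linarith)
  linarith

theorem localConvexExtension_eq_convexEnvelope {n : ℕ} {f : (Fin n → ℤ) → EReal}
    (hf : ∀ x, f x ≠ ⊥) (hpoly : IsPolyhedralConvexFun (convexEnvelope f))
    (hext : ∀ x : Fin n → ℤ, convexEnvelope f (toReal x) = f x)
    (hIC : ∀ p α, IsMinorant f p α → (contactSet f p α).Nonempty →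
      IsIntegrallyConvexSet (contactSet f p α)) :
    localConvexExtension f = convexEnvelope f := by
  funext x
  refine le_antisymm ?_ (convexEnvelope_le_localConvexExtension f x)
  by_cases hx : convexEnvelope f x = ⊤
  · rw [hx]
    exact le_top
  obtain ⟨_, _, q, α, hq, hcover⟩ := exists_affine_pieces hf hpoly hext
  obtain ⟨k, hk⟩ := hcover x hx
  have hmem := mem_convexHull_contactSet hf hpoly hext hIC (hq k) hk
  rw [hk]
  exact localConvexExtension_le ((isIntegrallyConvexSet_iff.1 (hIC _ _ (hq k)
    (convexHull_nonempty_iff.1 ⟨x, hmem⟩).of_image)).2 x hmem)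

end IntConv

theorem theorem4p3 (n : ℕ) (f : (Fin n → ℤ) → EReal)
    (hf : ∀ x, f x ≠ ⊥)
    (hpoly : IntConv.IsPolyhedralConvexFun (IntConv.convexEnvelope f))
    (hext : ∀ x : Fin n → ℤ, IntConv.convexEnvelope f (IntConv.toReal x) = f x) :
    IntConv.IsIntegrallyConvexFun f ↔
      ∀ p : Fin n → ℝ, IntConv.AttainsFiniteMin (IntConv.tilt f p) →
        IntConv.IsIntegrallyConvexSet (IntConv.argmin (IntConv.tilt f p)) := by
  constructor
  · intro h p hp
    obtain ⟨α, hα, hne⟩ := hp.exists_isMinorant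
    rw [(hα.argmin_tilt hne).1]
    exact h.isIntegrallyConvexSet_contactSet hα hne
  · intro h
    rw [IntConv.IsIntegrallyConvexFun,
      IntConv.localConvexExtension_eq_convexEnvelope hf hpoly hext fun p α hp hne => ?_]
    · exact hpoly.isConvexFun
    · obtain ⟨harg, hmin⟩ := hp.argmin_tilt hne
      exact harg ▸ h p hmin
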